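/- Let $G$ be a finite group. Then there exist a nonempty directed partially ordered set $I$, finite perfect groups $P_i$ ($i\in I$) (that is, $P_i=[P_i,P_i]$), and surjective group homomorphisms $f_{ij}\colon P_j\to P_i$ for $i\le j$, with $f_{ii}=\mathrm{id}$ and $f_{ij}\circ f_{jk}=f_{ik}$ for $i\le j\le k$, such that $G$ is an abstract quotient of the projective limit $$\varprojlim_{i\in I}P_i=\Bigl\{(x_i)_{i\in I}\in\prod_{i\in I}P_i : f_{ij}(x_j)=x_i\text{ for all }i\le j\Bigr\};$$ that is, there is a surjective (not necessarily continuous) group homomorphism $\varprojlim_{i\in I}P_i\to G$. -/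

import Mathlib

/-- The projective limit of an inverse system of groups `P i` with transition homomorphisms
`f h : P j →* P i` for `h : i ≤ j`, realised as the subgroup of `∀ i, P i` of compatible
families. -/
def projectiveLimit {I : Type*} [Preorder I] {P : I → Type*} [∀ i, Group (P i)]
    (f : ∀ ⦃i j : I⦄, i ≤ j → P j →* P i) : Subgroup (∀ i, P i) where
  carrier := {x | ∀ ⦃i j : I⦄ (h : i ≤ j), f h (x j) = x i}
  one_mem' := fun _ _ h => map_one (f h)
  mul_mem' := fun {x y} hx hy i j h => by
    simp only [Pi.mul_apply, map_mul, hx h, hy h]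
  inv_mem' := fun {x} hx i j h => by
    simp only [Pi.inv_apply, map_inv, hx h]

/-! Take `A` finite perfect (here A₅), and let `A^m` act on the (i, j) component `A → G` by
translating by the i-th coordinate on the left and the j-th on the right. The normal closures of
`A^m` are finite and perfect, and restriction of indices makes them an inverse system. On any finite
set of elements of the limit, pigeonhole gives i ≠ j whose `A`-coordinates agree; the twist then
fixes `1`, so evaluating component (i, j) at `1` is multiplicative there. An ultrafilter limit of
these evaluations is a homomorphism, and the dipoles, which lie in every core, make it onto. -/

/-- The normal closure of a perfect subgroup is perfect. -/
theorem Subgroup.isPerfect_normalClosure {G : Type*} [Group G] (H : Subgroup G)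
    [Group.IsPerfect H] : Group.IsPerfect (Subgroup.normalClosure (H : Set G)) := by
  rw [Subgroup.isPerfect_iff]
  refine le_antisymm (Subgroup.commutator_le_self _) (Subgroup.normalClosure_le_normal ?_)
  have h : H ≤ Subgroup.normalClosure (H : Set G) := Subgroup.subset_normalClosure
  calc (H : Set G) = (⁅H, H⁆ : Subgroup G) := by rw [Subgroup.commutator_eq_self]
    _ ⊆ _ := Subgroup.commutator_mono h h

/-- A finite power of a perfect group is perfect. -/
theorem Group.isPerfect_pi_of_finite {J A : Type*} [Finite J] [Group A] [Group.IsPerfect A] :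
    Group.IsPerfect (J → A) := by
  rw [Group.isPerfect_def, eq_top_iff]
  classical
  intro x _
  refine Subgroup.pi_mem_of_mulSingle_mem x fun j => ?_
  have h : (commutator A).map (MonoidHom.mulSingle (fun _ : J => A) j) ≤ commutator (J → A) := by
    rw [commutator_def, Subgroup.map_commutator, commutator_def]
    exact Subgroup.commutator_mono le_top le_top
  exact h (Subgroup.mem_map_of_mem _ Group.IsPerfect.mem_commutator)

/-- A compactness principle: if on every finite subset of `Γ` there is a multiplicative function to
the finite group `G` sending `T g` to `g`, then there is a homomorphism with this property. -/
theorem exists_monoidHom_of_forall_finset {Γ G : Type*} [Group Γ] [Group G] [Finite G]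
    (T : G → Γ)
    (h : ∀ F : Finset Γ, ∃ c : Γ → G,
      (∀ x ∈ F, ∀ y ∈ F, c (x * y) = c x * c y) ∧ ∀ g, c (T g) = g) :
    ∃ φ : Γ →* G, ∀ g, φ (T g) = g := by
  choose c hc hT using h
  -- An ultrafilter finer than `atTop` contains every cone of finite sets, and finiteness of `G`
  -- makes each value eventually constant along it.
  let U : Ultrafilter (Finset Γ) := Ultrafilter.of Filter.atTop
  have hU : ∀ x : Γ, ∀ᶠ F in (U : Filter (Finset Γ)), x ∈ F := fun x =>
    Ultrafilter.of_le _ <| (Filter.eventually_ge_atTop {x}).mono fun F hF =>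
      hF (Finset.mem_singleton_self x)
  have hlim : ∀ x : Γ, ∃ g : G, ∀ᶠ F in (U : Filter (Finset Γ)), c F x = g := by
    intro x
    obtain ⟨g, hg⟩ := Ultrafilter.eq_pure_of_finite (U.map fun F => c F x)
    refine ⟨g, ?_⟩
    have : ({g} : Set G) ∈ U.map fun F => c F x := by rw [hg]; exact Set.mem_singleton g
    exact this
  choose φ hφ using hlim
  refine ⟨MonoidHom.mk' φ fun x y => ?_, fun g => ?_⟩
  · obtain ⟨F, hxy, hx, hy, hxF, hyF⟩ := ((hφ (x * y)).and <| (hφ x).and <| (hφ y).and <|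
      (hU x).and (hU y)).exists
    rw [← hxy, ← hx, ← hy, hc F x hxF y hyF]
  · obtain ⟨F, hF⟩ := (hφ (T g)).exists
    exact hF.symm.trans (hT F g)

namespace TwistedWreath

/-- The group `J → A` acts on `J → J → A → G`: in the component indexed by `(i, j)`, the element
`a` translates the argument by `a i` on the left and by `a j` on the right. -/
def action (J A G : Type*) [Group A] [Group G] : (J → A) →* MulAut (J → J → A → G) where
  toFun a :=
    { toFun := fun f i j y => f i j ((a i)⁻¹ * y * a j)
      invFun := fun f i j y => f i j (a i * y * (a j)⁻¹)
      left_inv := fun f => by ext i j y; simp [mul_assoc]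
      right_inv := fun f => by ext i j y; simp [mul_assoc]
      map_mul' := fun _ _ => rfl }
  map_one' := by ext f i j y; simp
  map_mul' a b := by ext f i j y; simp [mul_assoc]

@[simp]
theorem action_apply {J A G : Type*} [Group A] [Group G] (a : J → A) (f : J → J → A → G)
    (i j : J) (y : A) : action J A G a f i j y = f i j ((a i)⁻¹ * y * a j) := rfl

/-- The semidirect product of `J → J → A → G` with `J → A` along the twisted action. -/
abbrev Full (J A G : Type*) [Group A] [Group G] : Type _ :=
  (J → J → A → G) ⋊[action J A G] (J → A)

/-- The normal closure of the complement `J → A` in the semidirect product. -/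
def core (J A G : Type*) [Group A] [Group G] : Subgroup (Full J A G) :=
  Subgroup.normalClosure ((SemidirectProduct.inr : (J → A) →* Full J A G).range : Set (Full J A G))

section

variable {J J' A G : Type*} [Group A] [Group G]

theorem isPerfect_core [Finite J] [Group.IsPerfect A] : Group.IsPerfect (core J A G) := by
  have := Group.isPerfect_pi_of_finite (J := J) (A := A)
  have := Group.IsPerfect.range (SemidirectProduct.inr : (J → A) →* Full J A G)
  exact Subgroup.isPerfect_normalClosure _

theorem finite_full [Finite J] [Finite A] [Finite G] : Finite (Full J A G) :=
  Finite.of_equiv _ SemidirectProduct.equivProd.symm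

/-- Restriction of the coordinates along a map of index types. -/
def restrict (e : J → J') : Full J' A G →* Full J A G where
  toFun x := ⟨fun i j => x.left (e i) (e j), fun i => x.right (e i)⟩
  map_one' := rfl
  map_mul' _ _ := rfl

theorem restrict_surjective {e : J → J'} (he : Function.Injective e) :
    Function.Surjective (restrict e : Full J' A G →* Full J A G) := by
  intro x
  refine ⟨⟨fun i' j' => Function.extend (Prod.map e e) (Function.uncurry x.left) 1 (i', j'),
    Function.extend e x.right 1⟩, ?_⟩
  refine SemidirectProduct.ext ?_ ?_
  · funext i j
    exact (he.prodMap he).extend_apply (Function.uncurry x.left) 1 (i, j)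
  · funext i
    exact he.extend_apply x.right 1 i

theorem map_restrict_core {e : J → J'} (he : Function.Injective e) :
    (core J' A G).map (restrict e) = core J A G := by
  rw [core, core, Subgroup.map_normalClosure _ _ (restrict_surjective he)]
  congr 1
  ext x
  constructor
  · rintro ⟨_, ⟨a, rfl⟩, rfl⟩
    exact ⟨fun i => a (e i), rfl⟩
  · rintro ⟨a, rfl⟩
    exact ⟨_, ⟨Function.extend e a 1, rfl⟩,
      SemidirectProduct.ext rfl (funext fun i => he.extend_apply a 1 i)⟩

/-- The restriction homomorphism between the normal closures. -/
def restrictCore {e : J → J'} (he : Function.Injective e) : core J' A G →* core J A G :=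
  ((restrict e).comp (core J' A G).subtype).codRestrict _ fun x =>
    (map_restrict_core (A := A) (G := G) he).le (Subgroup.mem_map_of_mem _ x.2)

theorem restrictCore_surjective {e : J → J'} (he : Function.Injective e) :
    Function.Surjective (restrictCore he : core J' A G →* core J A G) := by
  rintro ⟨x, hx⟩
  rw [← map_restrict_core he] at hx
  obtain ⟨y, hy, rfl⟩ := hx
  exact ⟨⟨y, hy⟩, rfl⟩

/-- This element is the commutator of `inl f` and `inr a`. -/
theorem inl_mul_action_inv_mem_core (f : J → J → A → G) (a : J → A) :
    SemidirectProduct.inl (f * (action J A G a f)⁻¹) ∈ core J A G := by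
  have ha : (SemidirectProduct.inr a : Full J A G) ∈ core J A G :=
    Subgroup.subset_normalClosure ⟨a, rfl⟩
  have hn : (core J A G).Normal := Subgroup.normalClosure_normal
  have := mul_mem (hn.conj_mem _ ha (SemidirectProduct.inl f)) (inv_mem ha)
  convert this using 1
  rw [map_mul, map_inv, SemidirectProduct.inl_aut, map_inv]
  simp only [mul_inv_rev, inv_inv, mul_assoc]

variable [DecidableEq J] [DecidableEq A]

/-- The function equal to `g` at `1` and to `g⁻¹` at `c` in each off-diagonal component, and trivial
elsewhere. -/
def dipole (J : Type*) [DecidableEq J] (c : A) (g : G) : J → J → A → G := fun i j =>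
  if i = j then 1 else Pi.mulSingle 1 g * (Pi.mulSingle c g)⁻¹

theorem inl_dipole_mem_core [Finite J] (c : A) (g : G) :
    SemidirectProduct.inl (dipole J c g) ∈ core J A G := by
  rw [← Subgroup.mem_comap]
  refine Subgroup.pi_mem_of_mulSingle_mem _ fun i => ?_
  rw [← MonoidHom.mulSingle_apply, ← Subgroup.mem_comap]
  refine Subgroup.pi_mem_of_mulSingle_mem _ fun j => ?_
  rw [Subgroup.mem_comap, MonoidHom.mulSingle_apply, Subgroup.mem_comap]
  by_cases hij : i = j
  · simp [dipole, hij]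
  -- As i ≠ j, putting `c` in coordinate i alone gives a pure left translation, moving the mass from
  -- `1` to `c`. On the diagonal the action is conjugation, which fixes `1`.
  · have key := inl_mul_action_inv_mem_core (J := J) (A := A) (G := G)
      (Pi.mulSingle i (Pi.mulSingle j (Pi.mulSingle 1 g))) (Pi.mulSingle i c)
    convert key using 2
    funext k l y
    rcases eq_or_ne k i with rfl | hk
    · rcases eq_or_ne l j with rfl | hl
      · have : Pi.mulSingle (M := fun _ : A => G) c g y =
            Pi.mulSingle (M := fun _ : A => G) 1 g (c⁻¹ * y) := by
          simp only [Pi.mulSingle_apply, inv_mul_eq_one, eq_comm]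
        simp [dipole, hij, Ne.symm hij, this]
      · simp [hl]
    · simp [hk]

end

end TwistedWreath

open TwistedWreath in
theorem mainTheorem3 {G : Type*} [Group G] [Finite G] :
    ∃ (I : Type) (_ : PartialOrder I) (_ : Nonempty I) (_ : IsDirectedOrder I)
      (P : I → Type) (_ : ∀ i, Group (P i))
      (f : ∀ ⦃i j : I⦄, i ≤ j → P j →* P i),
      (∀ i, Finite (P i)) ∧
      (∀ i, Group.IsPerfect (P i)) ∧
      InverseSystem (fun ⦃i j : I⦄ (h : i ≤ j) => (f h : P j → P i)) ∧
      (∀ ⦃i j : I⦄ (h : i ≤ j), Function.Surjective (f h)) ∧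
      ∃ φ : projectiveLimit f →* G, Function.Surjective φ := by
  obtain ⟨G', _, _, ⟨e⟩⟩ := Finite.exists_type_univ_nonempty_mulEquiv.{_, 0} G
  let A := alternatingGroup (Fin 5)
  have hA : Group.IsPerfect A :=
    ⟨commutator_alternatingGroup_eq_top (by simp)⟩
  obtain ⟨c, hc⟩ := exists_ne (1 : A)
  let f : ∀ ⦃i j : ℕ⦄, i ≤ j → core (Fin j) A G' →* core (Fin i) A G' :=
    fun i j h => restrictCore (Fin.castLE_injective h)
  refine ⟨ℕ, inferInstance, inferInstance, inferInstance, fun m => core (Fin m) A G',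
    inferInstance, f, fun m => ?_, fun m => isPerfect_core, ⟨fun _ _ => rfl, fun _ _ _ _ _ _ => rfl⟩,
    fun i j h => restrictCore_surjective _, ?_⟩
  · have := finite_full (J := Fin m) (A := A) (G := G')
    infer_instance
  let T : G' → projectiveLimit f := fun g =>
    ⟨fun m => ⟨_, inl_dipole_mem_core (J := Fin m) c g⟩, fun i j h => by
      refine Subtype.ext (SemidirectProduct.ext ?_ rfl)
      funext k l
      simp [f, restrictCore, restrict, dipole]⟩
  suffices h : ∃ φ : projectiveLimit f →* G', ∀ g, φ (T g) = g by
    obtain ⟨φ, hφ⟩ := h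
    exact ⟨e.symm.toMonoidHom.comp φ, e.symm.surjective.comp fun g => ⟨T g, hφ g⟩⟩
  refine exists_monoidHom_of_forall_finset T fun F => ?_
  -- Infinitely many indices, but only finitely many functions `F → A`. Coordinate i is read at
  -- level i + 1, the first where it exists.
  obtain ⟨i, j, hij, heq⟩ := Finite.exists_ne_map_eq_of_infinite
    fun (i : ℕ) (x : F) => (x.1.1 (i + 1)).1.right (Fin.last i)
  let M := max i j + 1
  let i' : Fin M := ⟨i, by omega⟩
  let j' : Fin M := ⟨j, by omega⟩
  have hright : ∀ x ∈ F, (x.1 M).1.right i' = (x.1 M).1.right j' := by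
    intro x hx
    have h1 := congrArg (fun z => z.1.right (Fin.last i)) (x.2 (show i + 1 ≤ M by omega))
    have h2 := congrArg (fun z => z.1.right (Fin.last j)) (x.2 (show j + 1 ≤ M by omega))
    exact h1.trans ((congrFun heq ⟨x, hx⟩).trans h2.symm)
  refine ⟨fun x => (x.1 M).1.left i' j' 1, fun x hx y _ => ?_, fun g => ?_⟩
  · have : (x.1 M).1.left i' j' 1 * (y.1 M).1.left i' j'
        (((x.1 M).1.right i')⁻¹ * 1 * (x.1 M).1.right j') =
        (x.1 M).1.left i' j' 1 * (y.1 M).1.left i' j' 1 := by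
      rw [hright x hx, mul_one, inv_mul_cancel]
    exact this
  · have : i' ≠ j' := fun h => hij (congrArg Fin.val h)
    -- Since `c ≠ 1`, the factor at `c` does not affect the value at `1`.
    simp [T, dipole, this, hc.symm]
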